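/- Let $(M,g)$ be a (finite-dimensional, smooth) semi-Riemannian manifold, let $\varepsilon,\widetilde\varepsilon\in\{1,-1\}$, let $I\subseteq\mathbb{R}$ be an open interval, and let $\pi:(M,g)\to(I,\widetilde\varepsilon\,ds^2)$ be a (surjective) semi-Riemannian submersion. For $s\in I$ and $x\in\pi^{-1}(s)$, define the mean curvature of the fiber $\pi^{-1}(s)$ at $x$ as the trace, with respect to $g|_{\ker d\pi_x}$, of the bilinear form $(v,w)\mapsto g(\nabla_v\nabla\pi,w)$ on $\ker d\pi_x=T_x\pi^{-1}(s)$, where $\nabla\pi$ is the $g$-gradient of $\pi$ (a unit normal field of the fibers) and $\nabla_v$ is the Levi-Civita connection of $g$. Assume that each fiber has constant mean curvature, and let $h:I\to\mathbb{R}$ be the function such that the mean curvature of $\pi^{-1}(s)$ is $h(s)$ for every $s\in I$. Let $u\in C^2(M)$ be constant along the fibers of $\pi$, let $f:I\to\mathbb{R}$ be the function with $u=f\circ\pi$, and let $F:M\to M\times\mathbb{R}$, $F(x)=(x,u(x))$, be the graph map of $u$. Assume that $F$ is a semi-Riemannian hypersurface of $(M\times\mathbb{R},\bar g=g+\varepsilon\,dt^2)$,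 i.e. that the induced form $\gamma=F^*\bar g$ is nondegenerate at every point. Then $F$ is a translating soliton, i.e. its mean curvature vector $\vec H=\mathrm{tr}_\gamma(\mathrm{II})$ (with $\mathrm{II}$ the second fundamental form of $F$) equals the normal component $\partial_t^{\perp}$ of $\partial_t$ along $F$, if and only if $f\in C^2(I)$ and $$f''(s)=\bigl(\widetilde\varepsilon+\varepsilon f'(s)^2\bigr)\bigl(1-f'(s)h(s)\bigr)\qquad\text{for all } s\in I .$$ -/

import Mathlib

open scoped Manifold ContDiff

/-!  Semi-Riemannian geometry on manifolds without boundary.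

Mathlib defines the tangent space `TangentSpace I x` of `M` at `x` as the model vector space `E`: a
tangent vector at `x` is the list of its components in the preferred chart `extChartAt I x` around
`x`, and `mfderiv I I' F x` is the derivative of `F` read in the preferred charts around `x` and `F x`.
Below, `T_x M` is written `E` and elements of `E` that are attached to a point `x` are tangent vectors
at `x` in this sense. Connections and second derivatives at `x` are computed in the preferred
chart around `x`. -/

noncomputable section

namespace SemiRiem

/-- The trace `∑ᵢⱼ bⁱʲ B(eᵢ, eⱼ)` of a bilinear map `B` with respect to a nondegenerate symmetric
bilinear form `b`, where `(bⁱʲ)` is the inverse of the Gram matrix `b(eᵢ, eⱼ)`.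
It does not depend on the basis `e` of `V`. -/
def metricTrace {V W : Type*} [AddCommGroup V] [Module ℝ V] [FiniteDimensional ℝ V]
    [AddCommGroup W] [Module ℝ W] (b : V → V → ℝ) (B : V → V → W) : W :=
  ∑ i, ∑ j,
    ((Matrix.of fun k l => b (Module.finBasis ℝ V k) (Module.finBasis ℝ V l))⁻¹ i j) •
      B (Module.finBasis ℝ V i) (Module.finBasis ℝ V j)

section Manifold

variable {E : Type*} [NormedAddCommGroup E] [NormedSpace ℝ E]
  {H : Type*} [TopologicalSpace H] (I : ModelWithCorners ℝ E H)
  {M : Type*} [TopologicalSpace M] [ChartedSpace H M]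
  {E' : Type*} [NormedAddCommGroup E'] [NormedSpace ℝ E']
  {H' : Type*} [TopologicalSpace H'] (I' : ModelWithCorners ℝ E' H')
  {P : Type*} [TopologicalSpace P] [ChartedSpace H' P]

/-- The differential `dF_x : T_x M → T_{F x} P`. -/
def dmap (F : M → P) (x : M) : E →L[ℝ] E' :=
  mfderiv I I' F x

/-- The differential `dφ_x : T_x M → ℝ` of a real function. -/
def differential (φ : M → ℝ) (x : M) : E →L[ℝ] ℝ :=
  mfderiv I 𝓘(ℝ, ℝ) φ x

/-- A field of bilinear forms on a manifold: `g x` is a bilinear form on `T_x M`. -/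
abbrev BilinField (E : Type*) [NormedAddCommGroup E] [NormedSpace ℝ E] (M : Type*) : Type _ :=
  M → E →L[ℝ] E →L[ℝ] ℝ

/-- The components of `g` in the chart around `x₀`: the pullback of `g` to the model space `E` by
the inverse of that chart. -/
def inChart (g : BilinField E M) (x₀ : M) (y : E) : E →L[ℝ] E →L[ℝ] ℝ :=
  (g ((extChartAt I x₀).symm y)).bilinearComp
    (dmap 𝓘(ℝ, E) I (extChartAt I x₀).symm y) (dmap 𝓘(ℝ, E) I (extChartAt I x₀).symm y)

/-- A semi-Riemannian metric: a smooth field of symmetric nondegenerate bilinear forms.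
(On a connected manifold the index is then constant.) -/
structure IsSemiRiemannianMetric (g : BilinField E M) : Prop where
  symm : ∀ x v w, g x v w = g x w v
  nondegenerate : ∀ x v, (∀ w, g x v w = 0) → v = 0
  smooth : ∀ x₀ : M, ContDiffOn ℝ ∞ (inChart I g x₀) (extChartAt I x₀).target

/-- The Christoffel symbol `Γ_x(v, w) = ∑ vⁱ wʲ Γᵏᵢⱼ(x) ∂ₖ` of the Levi-Civita connection of `g`, in
the chart around `x`: it is determined by
`g(Γ(v, w), z) = (1/2) (∂_v g (w, z) + ∂_w g (v, z) - ∂_z g (v, w))` for all `z`. -/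
def christoffel (g : BilinField E M) (x : M) (v w : E) : E :=
  let y : E := extChartAt I x x
  let D : E →L[ℝ] E →L[ℝ] E →L[ℝ] ℝ := fderiv ℝ (inChart I g x) y
  (inChart I g x y).inverse ((1 / 2 : ℝ) • (D v w + D w v - (D.flip v).flip w))

/-- The Levi-Civita covariant derivative `∇_v X ∈ T_x M` of a vector field `X`, for `v ∈ T_x M`:
in the chart around `x` it is `∂_v X + Γ(v, X)`. -/
def covDeriv (g : BilinField E M) (X : M → E) (x : M) (v : E) : E :=
  fderiv ℝ (fun y : E => dmap I 𝓘(ℝ, E) (extChartAt I x) ((extChartAt I x).symm y)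
    (X ((extChartAt I x).symm y))) (extChartAt I x x) v + christoffel I g x v (X x)

/-- The `g`-gradient of a real function: `g (∇φ, w) = dφ(w)` for all `w`. -/
def grad (g : BilinField E M) (φ : M → ℝ) (x : M) : E :=
  (g x).inverse (differential I φ x)

/-- The semi-Riemannian submersions `π : (M, g) → (J, δ ds²)` onto a set `J` of real numbers (in the
theorem an open interval, with `δ = ±1`): smooth submersions onto `J` whose fibers are
semi-Riemannian submanifolds and whose differential preserves the scalar products of the vectors
that are orthogonal to the fibers. -/
structure IsSemiRiemannianSubmersion (g : BilinField E M) (δ : ℝ) (J : Set ℝ)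
    (π : M → ℝ) : Prop where
  smooth : ContMDiff I 𝓘(ℝ, ℝ) ∞ π
  range_eq : Set.range π = J
  surjective : ∀ x, Function.Surjective (differential I π x)
  fiber_nondegenerate : ∀ x v, differential I π x v = 0 →
    (∀ w, differential I π x w = 0 → g x v w = 0) → v = 0
  isometry : ∀ x v w,
    (∀ z, differential I π x z = 0 → g x v z = 0) →
    (∀ z, differential I π x z = 0 → g x w z = 0) →
    δ * (differential I π x v * differential I π x w) = g x v w

/-- The mean curvature at `x` of the fiber of `π` through `x`, with respect to the normal field
`N = ∇π`: the trace of `(v, w) ↦ g (∇_v N, w)` over the tangent space `ker dπ_x` of the fiber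
(the trace itself, not its quotient by the dimension). -/
def fiberMeanCurvature [FiniteDimensional ℝ E] (g : BilinField E M) (π : M → ℝ) (x : M) : ℝ :=
  metricTrace (V := LinearMap.ker (differential I π x).toLinearMap)
    (fun v w => g x v w) (fun v w => g x (covDeriv I g (grad I g π) x v) w)

/-- The metric `g + ε dt²` on `M × ℝ`. -/
def prodMetric (g : BilinField E M) (ε : ℝ) : BilinField (E × ℝ) (M × ℝ) := fun q =>
  (g q.1).bilinearComp (ContinuousLinearMap.fst ℝ E ℝ) (ContinuousLinearMap.fst ℝ E ℝ) +
    ε • (ContinuousLinearMap.mul ℝ ℝ).bilinearComp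
      (ContinuousLinearMap.snd ℝ E ℝ) (ContinuousLinearMap.snd ℝ E ℝ)

/-- The form `γ = F^* g` induced on `M` by a map `F : M → (P, g)`. -/
def inducedMetric (g : BilinField E' P) (F : M → P) : BilinField E M := fun x =>
  (g (F x)).bilinearComp (dmap I I' F x) (dmap I I' F x)

/-- `F : M → (P, g)` is an (immersed, `C²`) semi-Riemannian submanifold: the induced form is
nondegenerate at every point (so that `dF` is injective). -/
def IsSemiRiemannianImmersion (g : BilinField E' P) (F : M → P) : Prop :=
  ContMDiff I I' 2 F ∧ ∀ x v, (∀ w, inducedMetric I I' g F x v w = 0) → v = 0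

/-- The component `z^⊥ = z - dF(t)` of `z ∈ T_{F x} P` normal to `F`; here `t ∈ T_x M` is determined by
`γ(t, w) = g(z, dF(w))` for all `w`. -/
def normalPart (g : BilinField E' P) (F : M → P) (x : M) (z : E') : E' :=
  z - dmap I I' F x
    ((inducedMetric I I' g F x).inverse ((g (F x) z).comp (dmap I I' F x)))

/-- The second fundamental form `II(v, w) = (∇_v dF(w))^⊥` of `F` at `x`, where `∇` is the Levi-Civita
connection of `(P, g)`. In the charts around `x` and `F x`, the vector field `dF(w)` along `F`, with
`w` extended by constant components, has the covariant derivative `D²F(v, w) + Γ(dF(v), dF(w))`. -/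
def secondFundamentalForm (g : BilinField E' P) (F : M → P) (x : M) (v w : E) : E' :=
  normalPart I I' g F x
    (fderiv ℝ (fderiv ℝ (writtenInExtChartAt I I' x F)) (extChartAt I x x) v w +
      christoffel I' g (F x) (dmap I I' F x v) (dmap I I' F x w))

/-- The mean curvature vector `tr_γ II` of `F` at `x`. -/
def meanCurvatureVector [FiniteDimensional ℝ E] (g : BilinField E' P) (F : M → P) (x : M) : E' :=
  metricTrace (fun v w => inducedMetric I I' g F x v w) (secondFundamentalForm I I' g F x)

/-- `F : M → (P × ℝ, g + ε dt²)` is a (vertical) translating soliton: a semi-Riemannian submanifold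
whose mean curvature vector is the normal component of `∂_t = (0, 1)`. -/
def IsTranslatingSoliton [FiniteDimensional ℝ E] (g : BilinField E' P) (ε : ℝ)
    (F : M → P × ℝ) : Prop :=
  IsSemiRiemannianImmersion I (I'.prod 𝓘(ℝ, ℝ)) (prodMetric g ε) F ∧
    ∀ x : M, meanCurvatureVector I (I'.prod 𝓘(ℝ, ℝ)) (prodMetric g ε) F x =
      normalPart I (I'.prod 𝓘(ℝ, ℝ)) (prodMetric g ε) F x (0, 1)

end Manifold

end SemiRiem

end

/-! For a graph, `dF(w) = (w, du(w))`, and the Christoffel symbols of `g + ε dt²` are those of `g`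
with zero vertical part. Hence `D²F + Γ = Hess u · ∂_t + dF(Γ)`, and taking normal parts gives `II =
Hess u ⊗ ∂_t^⊥`. Since `∂_t` is nowhere tangent to a graph, the soliton equation is the scalar
equation `tr_γ Hess u = 1` (`meanCurvatureVector_graph_eq_iff`).

Now let `u = f ∘ π` and `N = ∇π`. Then `γ = g + ε f'² dπ²` and `Hess u = f'' dπ² + f' Hess π`. The
submersion axioms give `g(N, N) = dπ(N) = δ`, and constancy of this length gives `Hess π(N, N) = 0`.
The hyperplane `ker dπ` and the line of `N` are orthogonal for `γ`, so the trace splits. On `ker dπ`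
the form `γ` is `g` and `Hess u` is `f' Hess π`, with trace `f' h`. On `N` the contribution is `f''
/ (δ + ε f'²)`. So the equation is `f' h + f'' / (δ + ε f'²) = 1` (`metricTrace_hessian_comp`). The
denominator is nonzero because otherwise `N` would lie in the kernel of `γ`.

The regularity of `f` follows from that of `u`, because `π` is a submersion: restricted to a
transversal line in a chart, it has a local inverse. -/

namespace SemiRiem

open Filter Topology

/-! ### Traces with respect to a bilinear form -/

section LinearAlgebra

variable {V : Type*} [AddCommGroup V] [Module ℝ V] [FiniteDimensional ℝ V]

theorem metricTrace_smul_const {W : Type*} [AddCommGroup W] [Module ℝ W]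
    (b B : V → V → ℝ) (n : W) :
    metricTrace b (fun v w => B v w • n) = metricTrace b B • n := by
  simp only [metricTrace, Finset.sum_smul, smul_eq_mul, mul_smul]

/-- Rewrites the double sum as a matrix trace, so that cyclicity of the trace yields independence of
the basis. The transpose stays because `B` is not assumed symmetric. -/
theorem sum_inv_mul_eq_trace {ι : Type*} [Fintype ι] [DecidableEq ι] (G B : Matrix ι ι ℝ) :
    ∑ i, ∑ j, G⁻¹ i j * B i j = (G⁻¹ * B.transpose).trace := by
  simp [Matrix.trace, Matrix.mul_apply]

/-- The metric trace may be computed in any basis. -/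
theorem metricTrace_eq_sum_basis {ι : Type*} [Fintype ι] [DecidableEq ι]
    (e : Module.Basis ι ℝ V) (b B : LinearMap.BilinForm ℝ V) :
    metricTrace (fun v w => b v w) (fun v w => B v w) =
      ∑ i, ∑ j, ((Matrix.of fun k l => b (e k) (e l))⁻¹ i j) * B (e i) (e j) := by
  set c := Module.finBasis ℝ V
  -- The basis in the definition is indexed by `Fin (finrank ℝ V)`; reindexing `e` makes the
  -- change-of-basis matrix square over one index type.
  let σ := e.indexEquiv c
  let e' := e.reindex σ
  have key : ∑ i, ∑ j, ((Matrix.of fun k l => b (e k) (e l))⁻¹ i j) * B (e i) (e j) =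
      ∑ i, ∑ j, ((Matrix.of fun k l => b (e' k) (e' l))⁻¹ i j) * B (e' i) (e' j) := by
    have hs : (Matrix.of fun k l => b (e' k) (e' l)) =
        (Matrix.of fun k l => b (e k) (e l)).submatrix σ.symm σ.symm := by
      ext i j; simp [e']
    rw [hs, Matrix.inv_submatrix_equiv]
    rw [← σ.symm.sum_comp]
    refine Finset.sum_congr rfl fun i _ => ?_
    rw [← σ.symm.sum_comp]
    simp [e']
  have tm : ∀ (d : Module.Basis (Fin (Module.finrank ℝ V)) ℝ V) (C : LinearMap.BilinForm ℝ V),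
      (Matrix.of fun k l => C (d k) (d l)) = LinearMap.BilinForm.toMatrix d C := by
    intro d C; ext i j; simp [LinearMap.BilinForm.toMatrix_apply]
  have tr : ∀ d : Module.Basis (Fin (Module.finrank ℝ V)) ℝ V,
      ∑ i, ∑ j, ((Matrix.of fun k l => b (d k) (d l))⁻¹ i j) * B (d i) (d j) =
      ((LinearMap.BilinForm.toMatrix d b)⁻¹ *
        (LinearMap.BilinForm.toMatrix d B).transpose).trace := by
    intro d
    rw [← sum_inv_mul_eq_trace, tm]
    simp [LinearMap.BilinForm.toMatrix_apply]
  rw [key, tr]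
  simp only [metricTrace, smul_eq_mul]
  rw [tr, ← LinearMap.BilinForm.toMatrix_mul_basis_toMatrix e' c b,
    ← LinearMap.BilinForm.toMatrix_mul_basis_toMatrix e' c B]
  set P := e'.toMatrix c
  have hP : IsUnit P.det := by
    have := Module.Basis.invertibleToMatrix e' c
    exact Matrix.isUnit_det_of_invertible _
  have hPT : IsUnit P.transpose.det := by rwa [Matrix.det_transpose]
  rw [Matrix.mul_inv_rev, Matrix.mul_inv_rev, Matrix.transpose_mul, Matrix.transpose_mul,
    Matrix.transpose_transpose]
  set G := LinearMap.BilinForm.toMatrix e' b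
  set C := (LinearMap.BilinForm.toMatrix e' B).transpose
  -- Gram matrices change by `PᵀGP`, so the product of the inverse Gram matrix with `C` changes by
  -- conjugation, which preserves the trace.
  have : P⁻¹ * (G⁻¹ * P.transpose⁻¹) * (P.transpose * (C * P)) = P⁻¹ * (G⁻¹ * C * P) := by
    simp only [Matrix.mul_assoc]
    rw [Matrix.nonsing_inv_mul_cancel_left _ _ hPT]
  rw [this, Matrix.trace_mul_comm, Matrix.mul_assoc, Matrix.mul_nonsing_inv _ hP, Matrix.mul_one]

/-- The metric trace splits along an orthogonal decomposition into a hyperplane and a line. -/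
theorem metricTrace_eq_add_of_orthogonal (b B : LinearMap.BilinForm ℝ V) (φ : V →ₗ[ℝ] ℝ) (N : V)
    (hsymm : ∀ v w, b v w = b w v) (hN : φ N ≠ 0) (h₁ : ∀ v, φ v = 0 → b v N = 0) (hNN : b N N ≠ 0)
    (hK : ∀ v, φ v = 0 → (∀ w, φ w = 0 → b v w = 0) → v = 0) :
    metricTrace (fun v w => b v w) (fun v w => B v w) =
      metricTrace (V := LinearMap.ker φ) (fun v w => b v w) (fun v w => B v w) +
        B N N / b N N := by
  let K := LinearMap.ker φ
  let c := Module.finBasis ℝ K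
  have hd : IsCompl K (ℝ ∙ N) := by
    constructor
    · rw [Submodule.disjoint_def]
      intro x hx hx'
      obtain ⟨a, rfl⟩ := Submodule.mem_span_singleton.1 hx'
      have : a * φ N = 0 := by simpa using LinearMap.mem_ker.1 hx
      rcases mul_eq_zero.1 this with h | h
      · simp [h]
      · exact absurd h hN
    · rw [codisjoint_iff, eq_top_iff]
      intro v _
      refine Submodule.mem_sup.2 ⟨v - (φ v / φ N) • N, ?_, (φ v / φ N) • N,
        Submodule.smul_mem _ _ (Submodule.mem_span_singleton_self N), by simp⟩
      rw [LinearMap.mem_ker]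
      simp [hN]
  let s : Module.Basis Unit ℝ (ℝ ∙ N) := by
    refine Module.Basis.singleton Unit ℝ |>.map (LinearEquiv.toSpanNonzeroSingleton ℝ V N ?_)
    rintro rfl; simp at hN
  let e : Module.Basis (Fin (Module.finrank ℝ K) ⊕ Unit) ℝ V :=
    (c.prod s).map (Submodule.prodEquivOfIsCompl K (ℝ ∙ N) hd)
  have el : ∀ i, e (Sum.inl i) = c i := by intro i; simp [e]
  have er : ∀ i, e (Sum.inr i) = N := by
    intro i; simp [e, s]
  -- Orthogonality of `N` to the hyperplane makes the Gram matrix block diagonal, and hence its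
  -- inverse too. Mixed values of `B` then have coefficient zero.
  have hb : (Matrix.of fun k l => b (e k) (e l)) =
      Matrix.fromBlocks (Matrix.of fun k l => b (c k) (c l)) 0 0 (Matrix.of fun _ _ => b N N) := by
    ext i j
    rcases i with i | i <;> rcases j with j | j <;> simp [el, er]
    · exact h₁ _ (c i).2
    · rw [hsymm]; exact h₁ _ (c j).2
  have hA : IsUnit (Matrix.of fun k l => b (c k) (c l)) := by
    have h3 : ((LinearMap.BilinForm.toMatrix c) (b.restrict K)).det ≠ 0 := by
      rw [← LinearMap.BilinForm.nondegenerate_iff_det_ne_zero]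
      have hr : (b.restrict K).IsRefl := fun v w hvw => by
        simpa [hsymm] using hvw
      refine hr.nondegenerate_iff_separatingLeft.2 ?_
      intro v hv
      exact Subtype.ext (hK v v.2 fun w hw => by simpa using hv ⟨w, hw⟩)
    rw [Matrix.isUnit_iff_isUnit_det, isUnit_iff_ne_zero]
    convert h3 using 2
    ext i j
    simp [LinearMap.BilinForm.toMatrix_apply]
  have hD : (Matrix.of fun (_ _ : Unit) => b N N)⁻¹ = Matrix.of fun (_ _ : Unit) => (b N N)⁻¹ := by
    apply Matrix.inv_eq_right_inv
    ext i j
    simp [Matrix.mul_apply, hNN]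
  rw [metricTrace_eq_sum_basis e, hb, Matrix.inv_fromBlocks_zero₂₁_of_isUnit_iff, hD]
  · simp [metricTrace, el, er]
    rw [mul_comm, ← div_eq_mul_inv]
  · refine iff_of_true hA ?_
    rw [Matrix.isUnit_iff_isUnit_det, isUnit_iff_ne_zero]
    simpa using hNN

end LinearAlgebra

/-! ### Nondegenerate forms as isomorphisms onto the dual -/

section Inverse

variable {E : Type*} [NormedAddCommGroup E] [NormedSpace ℝ E] [FiniteDimensional ℝ E]

/-- An injective map between spaces of equal finite dimension is bijective. This gives meaning to
every `inverse` in the definitions, which would be zero at a non-invertible map. -/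
theorem isInvertible_of_nondegenerate {b : E →L[ℝ] E →L[ℝ] ℝ}
    (hb : ∀ v, (∀ w, b v w = 0) → v = 0) : b.IsInvertible := by
  have hinj : Function.Injective b.toLinearMap := by
    rw [← LinearMap.ker_eq_bot, LinearMap.ker_eq_bot']
    intro v hv
    exact hb v fun w => by
      have := congrArg (fun l : E →L[ℝ] ℝ => l w) hv
      simpa using this
  have hdim : Module.finrank ℝ E = Module.finrank ℝ (E →L[ℝ] ℝ) := by
    rw [← (LinearMap.toContinuousLinearMap (𝕜 := ℝ) (E := E) (F' := ℝ)).finrank_eq]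
    exact (Subspace.dual_finrank_eq (K := ℝ) (V := E)).symm
  refine ⟨(LinearEquiv.ofInjectiveOfFinrankEq b.toLinearMap hinj hdim).toContinuousLinearEquiv, ?_⟩
  rfl

end Inverse

/-! ### Calculus in a single chart -/

section Calculus

variable {E : Type*} [NormedAddCommGroup E] [NormedSpace ℝ E]

/-- A function of one variable inherits regularity from its pullback by a submersion. -/
theorem contDiffAt_of_comp_submersion {f : ℝ → ℝ} {p : E → ℝ} {y : E} {n : ℕ∞ω} (hn : n ≠ 0)
    (hp : ContDiffAt ℝ n p y) (hd : fderiv ℝ p y ≠ 0) (hf : ContDiffAt ℝ n (f ∘ p) y) :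
    ContDiffAt ℝ n f (p y) := by
  obtain ⟨v, hv⟩ : ∃ v, fderiv ℝ p y v ≠ 0 := by
    by_contra! h
    exact hd (ContinuousLinearMap.ext h)
  -- On the line through `y` in a direction with `dp(v) ≠ 0`, `p` is a local diffeomorphism of `ℝ`.
  -- Near `p y` one has `f = (f ∘ p) ∘ l ∘ (p ∘ l)⁻¹`.
  let l : ℝ → E := fun t => y + t • v
  have hl0 : l 0 = y := by simp [l]
  have hl : ContDiff ℝ n l := by fun_prop
  have hlp : HasDerivAt l v 0 := by
    simpa [l] using ((hasDerivAt_id (0 : ℝ)).smul_const v).const_add y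
  have hq : ContDiffAt ℝ n (p ∘ l) 0 := ContDiffAt.comp 0 (by rwa [hl0]) hl.contDiffAt
  have hq' : HasDerivAt (p ∘ l) (fderiv ℝ p y v) 0 := by
    refine HasFDerivAt.comp_hasDerivAt (l := p) 0 ?_ hlp
    rw [hl0]
    exact (hp.differentiableAt hn).hasFDerivAt
  let e : ℝ ≃L[ℝ] ℝ := ContinuousLinearEquiv.unitsEquivAut ℝ (Units.mk0 _ hv)
  have hqe : HasFDerivAt (p ∘ l) (e : ℝ →L[ℝ] ℝ) 0 := by
    refine hq'.hasFDerivAt.congr_fderiv ?_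
    ext
    simp [e]
  have hs := hq.hasStrictFDerivAt' hqe hn
  have hinv := hq.to_localInverse hqe hn
  have hr := hs.eventually_right_inverse
  have hql : (p ∘ l) 0 = p y := by simp [hl0]
  have hi0 : hq.localInverse hqe hn ((p ∘ l) 0) = 0 := hs.localInverse_apply_image
  have : ContDiffAt ℝ n ((f ∘ p) ∘ (l ∘ hq.localInverse hqe hn)) ((p ∘ l) 0) := by
    refine ContDiffAt.comp _ ?_ (hl.contDiffAt.comp _ hinv)
    simp only [Function.comp_apply] at hi0 ⊢
    rw [hi0, hl0]
    exact hf
  rw [hql] at this hr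
  refine this.congr_of_eventuallyEq ?_
  filter_upwards [hr] with s hs
  exact congrArg f hs.symm

theorem fderiv_fderiv_comp_real {f : ℝ → ℝ} {p : E → ℝ} {y : E}
    (hp : ContDiffAt ℝ 2 p y) (hf : ContDiffAt ℝ 2 f (p y)) (v w : E) :
    fderiv ℝ (fderiv ℝ (f ∘ p)) y v w =
      deriv (deriv f) (p y) * (fderiv ℝ p y v * fderiv ℝ p y w) +
        deriv f (p y) * fderiv ℝ (fderiv ℝ p) y v w := by
  have h1 : fderiv ℝ (f ∘ p) =ᶠ[𝓝 y] fun z => deriv f (p z) • fderiv ℝ p z := by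
    have hf' := hp.continuousAt.eventually (hf.eventually (by simp))
    filter_upwards [hf', hp.eventually (by simp)] with z hz hz'
    have := (hz.differentiableAt two_ne_zero).hasDerivAt.comp_hasFDerivAt z
      (hz'.differentiableAt two_ne_zero).hasFDerivAt
    exact this.fderiv
  have hdp : DifferentiableAt ℝ (fderiv ℝ p) y :=
    (hp.fderiv_right (m := 1) (by norm_num)).differentiableAt one_ne_zero
  have hdf : DifferentiableAt ℝ (deriv f) (p y) := by
    have := (hf.fderiv_right (m := 1) (by norm_num)).differentiableAt one_ne_zero
    have h2 := this.clm_apply (differentiableAt_const (1 : ℝ))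
    exact h2
  have hc : HasFDerivAt (fun z => deriv f (p z)) (deriv (deriv f) (p y) • fderiv ℝ p y) y :=
    hdf.hasDerivAt.comp_hasFDerivAt y (hp.differentiableAt two_ne_zero).hasFDerivAt
  rw [h1.fderiv_eq, (hc.fun_smul hdp.hasFDerivAt).fderiv]
  simp
  ring

/-- The covariant derivative of a gradient is the Hessian. -/
theorem metric_covDeriv_grad_eq {G : E → E →L[ℝ] E →L[ℝ] ℝ} {p : E → ℝ} {X : E → E} {y : E}
    {c : E → E → E}
    (hG : DifferentiableAt ℝ G y) (hsymm : ∀ᶠ z in 𝓝 y, ∀ v w, G z v w = G z w v)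
    (hX : DifferentiableAt ℝ X y) (hXp : ∀ᶠ z in 𝓝 y, G z (X z) = fderiv ℝ p z)
    (hc : ∀ v w z, G y (c v w) z =
      (1 / 2 : ℝ) * (fderiv ℝ G y v w z + fderiv ℝ G y w v z - fderiv ℝ G y z v w)) (v w : E) :
    G y (fderiv ℝ X y v + c v (X y)) w =
      fderiv ℝ (fderiv ℝ p) y v w - fderiv ℝ p y (c v w) := by
  -- Symmetry of `G` near `y` passes to its derivative.
  have hD : ∀ v a b, fderiv ℝ G y v a b = fderiv ℝ G y v b a := by
    intro v a b
    have h1 : (fun z => G z a b) =ᶠ[𝓝 y] fun z => G z b a := by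
      filter_upwards [hsymm] with z hz using hz a b
    have h2 : ∀ a b, HasFDerivAt (fun z => G z a b)
        (((fderiv ℝ G y).flip a).flip b) y := by
      intro a b
      have := (hG.hasFDerivAt.clm_apply (hasFDerivAt_const a y)).clm_apply (hasFDerivAt_const b y)
      refine this.congr_fderiv ?_
      ext; simp
    have h3 := (h2 a b).fderiv
    rw [h1.fderiv_eq, (h2 b a).fderiv] at h3
    exact (congrArg (fun l : E →L[ℝ] ℝ => l v) h3).symm
  have h1 : fderiv ℝ (fderiv ℝ p) y v w = fderiv ℝ G y v (X y) w + G y (fderiv ℝ X y v) w := by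
    have h : (fun z => G z (X z)) =ᶠ[𝓝 y] fderiv ℝ p := hXp
    rw [← h.fderiv_eq, (hG.hasFDerivAt.clm_apply hX.hasFDerivAt).fderiv]
    simp [add_comm]
  have h2 : fderiv ℝ p y (c v w) = G y (c v w) (X y) := by
    rw [← hXp.self_of_nhds, hsymm.self_of_nhds]
  -- With `h1` from differentiating `G(X) = dp`, both sides equal `D²p(v, w) + (1/2)(-∂_v G(X, w) +
  -- ∂_X G(v, w) - ∂_w G(v, X))`.
  rw [h1, h2, map_add, add_apply, hc, hc, hD v w (X y), hD w v (X y),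
    hD (X y) v w]
  ring

/-- The integral curves of a gradient of constant length are geodesics. -/
theorem metric_covDeriv_grad_self_eq_zero {G : E → E →L[ℝ] E →L[ℝ] ℝ} {p : E → ℝ} {X : E → E}
    {y : E} {c : E → E → E} {δ : ℝ}
    (hG : DifferentiableAt ℝ G y) (hsymm : ∀ᶠ z in 𝓝 y, ∀ v w, G z v w = G z w v)
    (hX : DifferentiableAt ℝ X y) (hXp : ∀ᶠ z in 𝓝 y, G z (X z) = fderiv ℝ p z)
    (hp : DifferentiableAt ℝ (fderiv ℝ p) y) (hδ : ∀ᶠ z in 𝓝 y, fderiv ℝ p z (X z) = δ)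
    (hc : ∀ v w z, G y (c v w) z =
      (1 / 2 : ℝ) * (fderiv ℝ G y v w z + fderiv ℝ G y w v z - fderiv ℝ G y z v w)) :
    G y (fderiv ℝ X y (X y) + c (X y) (X y)) (X y) = 0 := by
  have h1 := metric_covDeriv_grad_eq hG hsymm hX hXp hc (X y) (X y)
  have h2 : G y (fderiv ℝ X y (X y) + c (X y) (X y)) (X y) =
      fderiv ℝ p y (fderiv ℝ X y (X y) + c (X y) (X y)) := by
    rw [← hXp.self_of_nhds, hsymm.self_of_nhds]
  -- Differentiates `dp(X) = δ` along `X`. The quantity sought is both `D²p(X, X) - dp(c(X, X))` and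
  -- `dp(∂_X X) + dp(c(X, X))`; these two expressions therefore add up to zero.
  have h3 : fderiv ℝ (fderiv ℝ p) y (X y) (X y) + fderiv ℝ p y (fderiv ℝ X y (X y)) = 0 := by
    have h : (fun z => fderiv ℝ p z (X z)) =ᶠ[𝓝 y] fun _ => δ := hδ
    have h4 : fderiv ℝ (fun z => fderiv ℝ p z (X z)) y = fderiv ℝ (fun _ : E => δ) y :=
      h.fderiv_eq
    rw [(hp.hasFDerivAt.clm_apply hX.hasFDerivAt).fderiv] at h4
    have h5 := congrArg (fun l : E →L[ℝ] ℝ => l (X y)) h4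
    simpa [add_comm] using h5
  rw [map_add (fderiv ℝ p y)] at h2
  linarith

end Calculus

/-! ### Metric, gradient and Hessian in the preferred charts -/

section Charts

variable {E : Type*} [NormedAddCommGroup E] [NormedSpace ℝ E]
  {M : Type*} [TopologicalSpace M] [ChartedSpace E M]

local notation "𝓜" => 𝓘(ℝ, E)

theorem extChartAt_target_mem_nhds_self (x : M) :
    (extChartAt 𝓜 x).target ∈ 𝓝 (extChartAt 𝓜 x x) :=
  (isOpen_extChartAt_target x).mem_nhds (mem_extChartAt_target x)

theorem dmap_extChartAt_dmap_symm [IsManifold 𝓜 1 M] {x : M} {y : E}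
    (hy : y ∈ (extChartAt 𝓜 x).target) (v : E) :
    dmap 𝓜 𝓘(ℝ, E) (extChartAt 𝓜 x) ((extChartAt 𝓜 x).symm y)
      (dmap 𝓘(ℝ, E) 𝓜 (extChartAt 𝓜 x).symm y v) = v := by
  have := mfderiv_extChartAt_comp_mfderivWithin_extChartAt_symm (I := 𝓜) hy
  rw [modelWithCornersSelf_coe, Set.range_id, mfderivWithin_univ] at this
  exact congrArg (fun l : E →L[ℝ] E => l v) this

theorem dmap_symm_dmap_extChartAt [IsManifold 𝓜 1 M] {x : M} {y : E}
    (hy : y ∈ (extChartAt 𝓜 x).target) (v : E) :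
    dmap 𝓘(ℝ, E) 𝓜 (extChartAt 𝓜 x).symm y
      (dmap 𝓜 𝓘(ℝ, E) (extChartAt 𝓜 x) ((extChartAt 𝓜 x).symm y) v) = v := by
  have := mfderivWithin_extChartAt_symm_comp_mfderiv_extChartAt (I := 𝓜) hy
  rw [modelWithCornersSelf_coe, Set.range_id, mfderivWithin_univ] at this
  exact congrArg (fun l : E →L[ℝ] E => l v) this

/-- Tangent vectors at `x` are components in the preferred chart at `x`, so that chart and its
inverse have the identity as derivative there. -/
theorem dmap_extChartAt_symm_self [IsManifold 𝓜 1 M] (x : M) :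
    dmap 𝓘(ℝ, E) 𝓜 (extChartAt 𝓜 x).symm (extChartAt 𝓜 x x) = ContinuousLinearMap.id ℝ E := by
  have := mfderivWithin_range_extChartAt_symm (I := 𝓜) (x := x)
  rw [modelWithCornersSelf_coe, Set.range_id, mfderivWithin_univ] at this
  exact this

theorem dmap_extChartAt_self [IsManifold 𝓜 1 M] (x : M) :
    dmap 𝓜 𝓘(ℝ, E) (extChartAt 𝓜 x) x = ContinuousLinearMap.id ℝ E :=
  mfderiv_extChartAt_self

theorem inChart_apply (g : BilinField E M) (x : M) (y v w : E) :
    inChart 𝓜 g x y v w = g ((extChartAt 𝓜 x).symm y)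
      (dmap 𝓘(ℝ, E) 𝓜 (extChartAt 𝓜 x).symm y v) (dmap 𝓘(ℝ, E) 𝓜 (extChartAt 𝓜 x).symm y w) :=
  rfl

theorem inChart_self [IsManifold 𝓜 1 M] (g : BilinField E M) (x : M) :
    inChart 𝓜 g x (extChartAt 𝓜 x x) = g x := by
  ext v w
  rw [inChart_apply, dmap_extChartAt_symm_self, extChartAt_to_inv]
  rfl

theorem inChart_symm {g : BilinField E M} (hg : IsSemiRiemannianMetric 𝓜 g) (x : M) (y v w : E) :
    inChart 𝓜 g x y v w = inChart 𝓜 g x y w v := by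
  simp [inChart, hg.symm]

theorem inChart_nondegenerate [IsManifold 𝓜 1 M] {g : BilinField E M}
    (hg : IsSemiRiemannianMetric 𝓜 g) {x : M} {y : E} (hy : y ∈ (extChartAt 𝓜 x).target) (v : E)
    (h : ∀ w, inChart 𝓜 g x y v w = 0) : v = 0 := by
  have := hg.nondegenerate _ (dmap 𝓘(ℝ, E) 𝓜 (extChartAt 𝓜 x).symm y v) fun w => by
    have := h (dmap 𝓜 𝓘(ℝ, E) (extChartAt 𝓜 x) ((extChartAt 𝓜 x).symm y) w)
    rwa [inChart_apply, dmap_symm_dmap_extChartAt hy] at this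
  rw [← dmap_extChartAt_dmap_symm hy v, this, map_zero]

theorem contDiffAt_inChart {g : BilinField E M} (hg : IsSemiRiemannianMetric 𝓜 g) {x : M} {y : E}
    (hy : y ∈ (extChartAt 𝓜 x).target) : ContDiffAt ℝ ∞ (inChart 𝓜 g x) y :=
  (hg.smooth x).contDiffAt ((isOpen_extChartAt_target x).mem_nhds hy)

theorem contDiffAt_comp_extChartAt_symm {n : ℕ∞ω} [IsManifold 𝓜 n M] {ψ : M → ℝ}
    (hψ : ContMDiff 𝓜 𝓘(ℝ, ℝ) n ψ) {x : M} {y : E} (hy : y ∈ (extChartAt 𝓜 x).target) :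
    ContDiffAt ℝ n (ψ ∘ (extChartAt 𝓜 x).symm) y := by
  have h := hψ.comp_contMDiffOn (contMDiffOn_extChartAt_symm (I := 𝓜) (n := n) x)
  exact (contMDiffOn_iff_contDiffOn.1 h).contDiffAt ((isOpen_extChartAt_target x).mem_nhds hy)

theorem fderiv_comp_extChartAt_symm [IsManifold 𝓜 1 M] {ψ : M → ℝ} {x : M} {y : E}
    (hy : y ∈ (extChartAt 𝓜 x).target)
    (hψ : MDifferentiableAt 𝓜 𝓘(ℝ, ℝ) ψ ((extChartAt 𝓜 x).symm y)) (v : E) :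
    fderiv ℝ (ψ ∘ (extChartAt 𝓜 x).symm) y v =
      differential 𝓜 ψ ((extChartAt 𝓜 x).symm y)
        (dmap 𝓘(ℝ, E) 𝓜 (extChartAt 𝓜 x).symm y v) := by
  have h := mdifferentiableWithinAt_extChartAt_symm (I := 𝓜) hy
  rw [modelWithCornersSelf_coe, Set.range_id, mdifferentiableWithinAt_univ] at h
  have h1 := mfderiv_comp y hψ h
  rw [mfderiv_eq_fderiv] at h1
  rw [h1]
  rfl

theorem fderiv_comp_extChartAt_symm_self {ψ : M → ℝ} {x : M}
    (hψ : MDifferentiableAt 𝓜 𝓘(ℝ, ℝ) ψ x) :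
    fderiv ℝ (ψ ∘ (extChartAt 𝓜 x).symm) (extChartAt 𝓜 x x) = differential 𝓜 ψ x := by
  rw [differential, hψ.mfderiv]
  simp [writtenInExtChartAt]
  rfl

/-- Replaces the inverse metric in the definition by the Koszul identity, the only form in which the
connection is used later. -/
theorem metric_christoffel [FiniteDimensional ℝ E] [IsManifold 𝓜 1 M] {g : BilinField E M}
    (hg : IsSemiRiemannianMetric 𝓜 g) (x : M) (v w z : E) :
    g x (christoffel 𝓜 g x v w) z = (1 / 2 : ℝ) *
      (fderiv ℝ (inChart 𝓜 g x) (extChartAt 𝓜 x x) v w z +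
        fderiv ℝ (inChart 𝓜 g x) (extChartAt 𝓜 x x) w v z -
        fderiv ℝ (inChart 𝓜 g x) (extChartAt 𝓜 x x) z v w) := by
  have hi := isInvertible_of_nondegenerate (hg.nondegenerate x)
  simp only [christoffel, inChart_self]
  rw [hi.self_apply_inverse]
  simp

theorem metric_grad [FiniteDimensional ℝ E] {g : BilinField E M}
    (hg : IsSemiRiemannianMetric 𝓜 g) (ψ : M → ℝ) (x : M) :
    g x (grad 𝓜 g ψ x) = differential 𝓜 ψ x :=
  (isInvertible_of_nondegenerate (hg.nondegenerate x)).self_apply_inverse _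

/-- The gradient of `ψ` in the chart around `x`. -/
noncomputable def gradInChart (g : BilinField E M) (ψ : M → ℝ) (x : M) (y : E) : E :=
  dmap 𝓜 𝓘(ℝ, E) (extChartAt 𝓜 x) ((extChartAt 𝓜 x).symm y)
    (grad 𝓜 g ψ ((extChartAt 𝓜 x).symm y))

theorem inChart_gradInChart [FiniteDimensional ℝ E] [IsManifold 𝓜 1 M] {g : BilinField E M}
    (hg : IsSemiRiemannianMetric 𝓜 g) {ψ : M → ℝ} (hψ : MDifferentiable 𝓜 𝓘(ℝ, ℝ) ψ) {x : M}
    {y : E} (hy : y ∈ (extChartAt 𝓜 x).target) :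
    inChart 𝓜 g x y (gradInChart g ψ x y) = fderiv ℝ (ψ ∘ (extChartAt 𝓜 x).symm) y := by
  ext w
  rw [fderiv_comp_extChartAt_symm hy (hψ _), ← metric_grad hg]
  rw [inChart_apply, gradInChart, dmap_symm_dmap_extChartAt hy]

theorem gradInChart_self [IsManifold 𝓜 1 M] (g : BilinField E M) (ψ : M → ℝ) (x : M) :
    gradInChart g ψ x (extChartAt 𝓜 x x) = grad 𝓜 g ψ x := by
  rw [gradInChart, extChartAt_to_inv, dmap_extChartAt_self]
  rfl

/-- In the chart the gradient is `G⁻¹ dψ`, and inversion of linear maps is smooth at invertible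
ones. -/
theorem differentiableAt_gradInChart [FiniteDimensional ℝ E] [IsManifold 𝓜 ∞ M]
    {g : BilinField E M}
    (hg : IsSemiRiemannianMetric 𝓜 g) {ψ : M → ℝ} (hψ : ContMDiff 𝓜 𝓘(ℝ, ℝ) ∞ ψ) (x : M) :
    DifferentiableAt ℝ (gradInChart g ψ x) (extChartAt 𝓜 x x) := by
  have hd : MDifferentiable 𝓜 𝓘(ℝ, ℝ) ψ := hψ.mdifferentiable (by simp)
  have hx := mem_extChartAt_target (I := 𝓜) x
  have hi : ∀ y ∈ (extChartAt 𝓜 x).target, (inChart 𝓜 g x y).IsInvertible := fun y hy =>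
    isInvertible_of_nondegenerate (inChart_nondegenerate hg hy)
  have he : gradInChart g ψ x =ᶠ[𝓝 (extChartAt 𝓜 x x)] fun y =>
      (inChart 𝓜 g x y).inverse (fderiv ℝ (ψ ∘ (extChartAt 𝓜 x).symm) y) := by
    filter_upwards [extChartAt_target_mem_nhds_self x] with y hy
    rw [← inChart_gradInChart hg hd hy, (hi y hy).inverse_apply_self]
  refine DifferentiableAt.congr_of_eventuallyEq ?_ he
  have : CompleteSpace E := FiniteDimensional.complete ℝ E
  have h1 := ((hi _ hx).contDiffAt_map_inverse (n := 1)).differentiableAt one_ne_zero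
  have h2 := (contDiffAt_inChart hg hx).differentiableAt (by simp)
  have h3 := ((contDiffAt_comp_extChartAt_symm hψ hx).fderiv_right (m := 1)
    (by norm_cast)).differentiableAt one_ne_zero
  exact (h1.comp _ h2).clm_apply h3

/-- The Hessian `∇dψ` of a function, in the chart around the base point. -/
noncomputable def hessian (g : BilinField E M) (ψ : M → ℝ) (x : M) (v w : E) : ℝ :=
  fderiv ℝ (fderiv ℝ (ψ ∘ (extChartAt 𝓜 x).symm)) (extChartAt 𝓜 x x) v w -
    differential 𝓜 ψ x (christoffel 𝓜 g x v w)

theorem metric_covDeriv_grad [FiniteDimensional ℝ E] [IsManifold 𝓜 ∞ M] {g : BilinField E M}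
    (hg : IsSemiRiemannianMetric 𝓜 g) {ψ : M → ℝ} (hψ : ContMDiff 𝓜 𝓘(ℝ, ℝ) ∞ ψ) (x : M)
    (v w : E) :
    g x (covDeriv 𝓜 g (grad 𝓜 g ψ) x v) w = hessian g ψ x v w := by
  have hd : MDifferentiable 𝓜 𝓘(ℝ, ℝ) ψ := hψ.mdifferentiable (by simp)
  have hx := mem_extChartAt_target (I := 𝓜) x
  have := metric_covDeriv_grad_eq (G := inChart 𝓜 g x) (X := gradInChart g ψ x)
    (p := ψ ∘ (extChartAt 𝓜 x).symm) (c := christoffel 𝓜 g x)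
    ((contDiffAt_inChart hg hx).differentiableAt (by simp))
    (Eventually.of_forall (inChart_symm hg x)) (differentiableAt_gradInChart hg hψ x)
    (by filter_upwards [extChartAt_target_mem_nhds_self x] with y hy
        using inChart_gradInChart hg hd hy)
    (by simpa only [inChart_self] using metric_christoffel hg x) v w
  rw [inChart_self, gradInChart_self, fderiv_comp_extChartAt_symm_self (hd x)] at this
  exact this

theorem hessian_grad_self_eq_zero [FiniteDimensional ℝ E] [IsManifold 𝓜 ∞ M]
    {g : BilinField E M} (hg : IsSemiRiemannianMetric 𝓜 g) {ψ : M → ℝ}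
    (hψ : ContMDiff 𝓜 𝓘(ℝ, ℝ) ∞ ψ) {δ : ℝ}
    (hδ : ∀ x, differential 𝓜 ψ x (grad 𝓜 g ψ x) = δ) (x : M) :
    hessian g ψ x (grad 𝓜 g ψ x) (grad 𝓜 g ψ x) = 0 := by
  have hd : MDifferentiable 𝓜 𝓘(ℝ, ℝ) ψ := hψ.mdifferentiable (by simp)
  have hx := mem_extChartAt_target (I := 𝓜) x
  have := metric_covDeriv_grad_self_eq_zero (G := inChart 𝓜 g x) (X := gradInChart g ψ x)
    (p := ψ ∘ (extChartAt 𝓜 x).symm) (c := christoffel 𝓜 g x) (δ := δ)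
    ((contDiffAt_inChart hg hx).differentiableAt (by simp))
    (Eventually.of_forall (inChart_symm hg x)) (differentiableAt_gradInChart hg hψ x)
    (by filter_upwards [extChartAt_target_mem_nhds_self x] with y hy
        using inChart_gradInChart hg hd hy)
    (((contDiffAt_comp_extChartAt_symm hψ hx).fderiv_right (m := 1)
      (by norm_cast)).differentiableAt one_ne_zero)
    (by
      filter_upwards [extChartAt_target_mem_nhds_self x] with y hy
      rw [fderiv_comp_extChartAt_symm hy (hd _), gradInChart, dmap_symm_dmap_extChartAt hy, hδ])
    (by simpa only [inChart_self] using metric_christoffel hg x)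
  rw [inChart_self, gradInChart_self] at this
  rw [← metric_covDeriv_grad hg hψ]
  exact this

theorem differential_comp {ψ : M → ℝ} {x : M}
    (hψ : MDifferentiableAt 𝓜 𝓘(ℝ, ℝ) ψ x) {f : ℝ → ℝ} (hf : DifferentiableAt ℝ f (ψ x)) :
    differential 𝓜 (f ∘ ψ) x = deriv f (ψ x) • differential 𝓜 ψ x := by
  have h := mfderiv_comp x hf.mdifferentiableAt hψ
  rw [mfderiv_eq_fderiv] at h
  ext v
  have h1 : differential 𝓜 (f ∘ ψ) x v = fderiv ℝ f (ψ x) (differential 𝓜 ψ x v) :=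
    congrArg (fun l : E →L[ℝ] ℝ => l v) h
  rw [h1, fderiv_eq_smul_deriv]
  simp [mul_comm]

/-- The Christoffel term involves only the first derivative, so by the chain rule it recombines with
`f' D²ψ` into `f' Hess ψ`. -/
theorem hessian_comp [IsManifold 𝓜 ∞ M] (g : BilinField E M) {ψ : M → ℝ}
    (hψ : ContMDiff 𝓜 𝓘(ℝ, ℝ) ∞ ψ) {f : ℝ → ℝ} {x : M} (hf : ContDiffAt ℝ 2 f (ψ x)) (v w : E) :
    hessian g (f ∘ ψ) x v w =
      deriv (deriv f) (ψ x) * (differential 𝓜 ψ x v * differential 𝓜 ψ x w) +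
        deriv f (ψ x) * hessian g ψ x v w := by
  have hd : MDifferentiable 𝓜 𝓘(ℝ, ℝ) ψ := hψ.mdifferentiable (by simp)
  have hx := mem_extChartAt_target (I := 𝓜) x
  have h0 : (ψ ∘ (extChartAt 𝓜 x).symm) (extChartAt 𝓜 x x) = ψ x := by
    rw [Function.comp_apply, extChartAt_to_inv]
  have h := fderiv_fderiv_comp_real (f := f)
    ((contDiffAt_comp_extChartAt_symm hψ hx).of_le (by norm_cast)) (by rwa [h0]) v w
  rw [h0, fderiv_comp_extChartAt_symm_self (hd x)] at h
  rw [hessian, hessian, differential_comp (hd x) (hf.differentiableAt two_ne_zero),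
    Function.comp_assoc, h, smul_apply, smul_eq_mul]
  ring

end Charts

/-! ### Product metric and geometry of graphs -/

section Graph

variable {E : Type*} [NormedAddCommGroup E] [NormedSpace ℝ E]
  {M : Type*} [TopologicalSpace M] [ChartedSpace E M]

local notation "𝓜" => 𝓘(ℝ, E)
local notation "𝓢" => ModelWithCorners.prod 𝓘(ℝ, E) 𝓘(ℝ, ℝ)

omit [TopologicalSpace M] [ChartedSpace E M] in
theorem prodMetric_apply (g : BilinField E M) (ε : ℝ) (q : M × ℝ) (v w : E × ℝ) :
    prodMetric g ε q v w = g q.1 v.1 w.1 + ε * (v.2 * w.2) := by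
  simp [prodMetric]

theorem dmap_extChartAt_prod_symm [IsManifold 𝓜 1 M] (x : M) (t : ℝ) {y : E × ℝ}
    (hy : y.1 ∈ (extChartAt 𝓜 x).target) (v : E × ℝ) :
    dmap 𝓘(ℝ, E × ℝ) 𝓢 (extChartAt 𝓢 (x, t)).symm y v =
      (dmap 𝓘(ℝ, E) 𝓜 (extChartAt 𝓜 x).symm y.1 v.1, v.2) := by
  have hfun : ((extChartAt 𝓢 (x, t)).symm : E × ℝ → M × ℝ) =
      fun z => ((extChartAt 𝓜 x).symm z.1, z.2) := by
    rw [extChartAt_prod]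
    rfl
  have h := mdifferentiableWithinAt_extChartAt_symm (I := 𝓜) hy
  rw [modelWithCornersSelf_coe, Set.range_id, mdifferentiableWithinAt_univ] at h
  have h1 : HasMFDerivAt 𝓘(ℝ, E × ℝ) 𝓘(ℝ, E) (Prod.fst : E × ℝ → E) y
      (ContinuousLinearMap.fst ℝ E ℝ) := (hasFDerivAt_fst).hasMFDerivAt
  have h2 : HasMFDerivAt 𝓘(ℝ, E × ℝ) 𝓘(ℝ, ℝ) (Prod.snd : E × ℝ → ℝ) y
      (ContinuousLinearMap.snd ℝ E ℝ) := (hasFDerivAt_snd).hasMFDerivAt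
  have h3 := ((h.hasMFDerivAt.comp y h1).prodMk h2).mfderiv
  rw [dmap, hfun]
  exact congrArg (fun l : E × ℝ →L[ℝ] E × ℝ => l v) h3

theorem inChart_prodMetric [IsManifold 𝓜 1 M] (g : BilinField E M) (ε : ℝ) (x : M) (t : ℝ)
    {y : E × ℝ} (hy : y.1 ∈ (extChartAt 𝓜 x).target) :
    inChart 𝓢 (prodMetric g ε) (x, t) y =
      (inChart 𝓜 g x y.1).bilinearComp (ContinuousLinearMap.fst ℝ E ℝ)
          (ContinuousLinearMap.fst ℝ E ℝ) +
        ε • (ContinuousLinearMap.mul ℝ ℝ).bilinearComp (ContinuousLinearMap.snd ℝ E ℝ)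
          (ContinuousLinearMap.snd ℝ E ℝ) := by
  have hfun : (extChartAt 𝓢 (x, t)).symm y = ((extChartAt 𝓜 x).symm y.1, y.2) := by
    rw [extChartAt_prod]
    rfl
  have h : ∀ v w, inChart 𝓢 (prodMetric g ε) (x, t) y v w =
      inChart 𝓜 g x y.1 v.1 w.1 + ε * (v.2 * w.2) := by
    intro v w
    rw [inChart_apply]
    change prodMetric g ε ((extChartAt 𝓢 (x, t)).symm y)
      (dmap 𝓘(ℝ, E × ℝ) 𝓢 (extChartAt 𝓢 (x, t)).symm y v)
      (dmap 𝓘(ℝ, E × ℝ) 𝓢 (extChartAt 𝓢 (x, t)).symm y w) = _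
    rw [dmap_extChartAt_prod_symm x t hy, dmap_extChartAt_prod_symm x t hy, prodMetric_apply, hfun]
  refine ContinuousLinearMap.ext fun v => ContinuousLinearMap.ext fun w => ?_
  rw [h]
  simp

theorem prodMetric_nondegenerate {g : BilinField E M} (hg : IsSemiRiemannianMetric 𝓜 g) {ε : ℝ}
    (hε : ε ≠ 0) (q : M × ℝ) (v : E × ℝ) (h : ∀ w, prodMetric g ε q v w = 0) : v = 0 := by
  refine Prod.ext (hg.nondegenerate q.1 _ fun w => ?_) ?_
  · simpa [prodMetric_apply] using h (w, 0)
  · simpa [prodMetric_apply, hε] using h (0, 1)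

/-- In a product chart `g + ε dt²` is a fixed linear image of `g`, depending on the first coordinate
alone, plus the constant form `ε dt²`. -/
theorem fderiv_comp_fst_add_const {E V W : Type*} [NormedAddCommGroup E] [NormedSpace ℝ E]
    [NormedAddCommGroup V] [NormedSpace ℝ V] [NormedAddCommGroup W] [NormedSpace ℝ W]
    (L : V →L[ℝ] W) (C : W) {G : E → V} {y : E × ℝ} (hG : DifferentiableAt ℝ G y.1) (a : E × ℝ) :
    fderiv ℝ (fun z : E × ℝ => L (G z.1) + C) y a = L (fderiv ℝ G y.1 a.1) := by
  have h := ((L.hasFDerivAt.comp y (hG.hasFDerivAt.comp y hasFDerivAt_fst)).add_const C).fderiv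
  exact congrArg (fun l : E × ℝ →L[ℝ] W => l a) h

/-- The Christoffel symbols of `g + ε dt²`. -/
theorem christoffel_prodMetric [FiniteDimensional ℝ E] [IsManifold 𝓜 1 M] {g : BilinField E M}
    (hg : IsSemiRiemannianMetric 𝓜 g) {ε : ℝ} (hε : ε ≠ 0) (x : M) (t : ℝ) (v w : E × ℝ) :
    christoffel 𝓢 (prodMetric g ε) (x, t) v w = (christoffel 𝓜 g x v.1 w.1, 0) := by
  have hx := mem_extChartAt_target (I := 𝓜) x
  have hy0 : (extChartAt 𝓢 (x, t) (x, t) : E × ℝ) = (extChartAt 𝓜 x x, t) := by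
    rw [extChartAt_prod]
    rfl
  have h0 : inChart 𝓢 (prodMetric g ε) (x, t) (extChartAt 𝓜 x x, t) = prodMetric g ε (x, t) := by
    rw [inChart_prodMetric g ε x t hx, inChart_self]
    rfl
  have hD : ∀ a b c : E × ℝ,
      fderiv ℝ (inChart 𝓢 (prodMetric g ε) (x, t)) (extChartAt 𝓜 x x, t) a b c =
        fderiv ℝ (inChart 𝓜 g x) (extChartAt 𝓜 x x) a.1 b.1 c.1 := by
    intro a b c
    let fst := ContinuousLinearMap.fst ℝ E ℝ
    let L₁ : (E →L[ℝ] E →L[ℝ] ℝ) →L[ℝ] (E × ℝ →L[ℝ] E →L[ℝ] ℝ) :=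
      (ContinuousLinearMap.compL ℝ (E × ℝ) E (E →L[ℝ] ℝ)).flip fst
    let L₂ : (E × ℝ →L[ℝ] E →L[ℝ] ℝ) →L[ℝ] (E × ℝ →L[ℝ] E × ℝ →L[ℝ] ℝ) :=
      ContinuousLinearMap.compL ℝ (E × ℝ) (E →L[ℝ] ℝ) (E × ℝ →L[ℝ] ℝ)
        ((ContinuousLinearMap.compL ℝ (E × ℝ) E ℝ).flip fst)
    let L := L₂.comp L₁
    have he : inChart 𝓢 (prodMetric g ε) (x, t) =ᶠ[𝓝 (extChartAt 𝓜 x x, t)] fun y =>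
        L (inChart 𝓜 g x y.1) +
          ε • (ContinuousLinearMap.mul ℝ ℝ).bilinearComp (ContinuousLinearMap.snd ℝ E ℝ)
            (ContinuousLinearMap.snd ℝ E ℝ) := by
      filter_upwards [continuousAt_fst.eventually (extChartAt_target_mem_nhds_self x)] with y hy
      exact inChart_prodMetric g ε x t hy
    rw [he.fderiv_eq]
    have hL := fderiv_comp_fst_add_const (V := E →L[ℝ] E →L[ℝ] ℝ)
      (W := E × ℝ →L[ℝ] E × ℝ →L[ℝ] ℝ) L
      (ε • (ContinuousLinearMap.mul ℝ ℝ).bilinearComp (ContinuousLinearMap.snd ℝ E ℝ)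
        (ContinuousLinearMap.snd ℝ E ℝ)) (y := (extChartAt 𝓜 x x, t))
      ((contDiffAt_inChart hg hx).differentiableAt (by simp)) a
    exact congrArg (fun l : E × ℝ →L[ℝ] E × ℝ →L[ℝ] ℝ => l b c) hL
  have hi := isInvertible_of_nondegenerate (prodMetric_nondegenerate hg hε (x, t))
  generalize hc : christoffel 𝓜 g x v.1 w.1 = c
  simp only [christoffel, hy0, h0]
  -- Instead of inverting the product metric, the candidate with zero vertical part is tested
  -- against its defining equation.
  rw [hi.inverse_apply_eq]
  refine ContinuousLinearMap.ext fun z => ?_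
  rw [prodMetric_apply]
  simp only [smul_apply, sub_apply, add_apply, ContinuousLinearMap.flip_apply, hD, smul_eq_mul]
  rw [← hc, metric_christoffel hg]
  ring

variable {u : M → ℝ}

theorem dmap_graph {x : M} (hu : MDifferentiableAt 𝓜 𝓘(ℝ, ℝ) u x) (v : E) :
    dmap 𝓜 𝓢 (fun x => (x, u x)) x v = (v, differential 𝓜 u x v) := by
  have h := ((hasMFDerivAt_id x).prodMk hu.hasMFDerivAt).mfderiv
  exact congrArg (fun l : E →L[ℝ] E × ℝ => l v) h

theorem inducedMetric_graph (g : BilinField E M) (ε : ℝ) {x : M}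
    (hu : MDifferentiableAt 𝓜 𝓘(ℝ, ℝ) u x) (v w : E) :
    inducedMetric 𝓜 𝓢 (prodMetric g ε) (fun x => (x, u x)) x v w =
      g x v w + ε * (differential 𝓜 u x v * differential 𝓜 u x w) := by
  change prodMetric g ε (x, u x) (dmap 𝓜 𝓢 (fun x => (x, u x)) x v)
    (dmap 𝓜 𝓢 (fun x => (x, u x)) x w) = _
  rw [dmap_graph hu, dmap_graph hu, prodMetric_apply]

/-- In charts the graph map is `y ↦ (y, u(y))`; its first component is linear, so only the vertical
second derivative survives. -/
theorem fderiv_fderiv_graph {x : M} (hu : ContMDiff 𝓜 𝓘(ℝ, ℝ) 2 u) [IsManifold 𝓜 2 M] (v w : E) :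
    fderiv ℝ (fderiv ℝ (writtenInExtChartAt 𝓜 𝓢 x (fun x => (x, u x)))) (extChartAt 𝓜 x x) v w =
      (0, fderiv ℝ (fderiv ℝ (u ∘ (extChartAt 𝓜 x).symm)) (extChartAt 𝓜 x x) v w) := by
  have hx := mem_extChartAt_target (I := 𝓜) x
  have h : writtenInExtChartAt 𝓜 𝓢 x (fun x => (x, u x)) =ᶠ[𝓝 (extChartAt 𝓜 x x)]
      fun y => (y, (u ∘ (extChartAt 𝓜 x).symm) y) := by
    filter_upwards [extChartAt_target_mem_nhds_self x] with y hy
    rw [writtenInExtChartAt, extChartAt_prod]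
    exact Prod.ext ((extChartAt 𝓜 x).right_inv hy) rfl
  have hc := contDiffAt_comp_extChartAt_symm hu hx
  have h' : fderiv ℝ (writtenInExtChartAt 𝓜 𝓢 x (fun x => (x, u x))) =ᶠ[𝓝 (extChartAt 𝓜 x x)]
      fun y => ContinuousLinearMap.inl ℝ E ℝ + ContinuousLinearMap.compL ℝ E ℝ (E × ℝ)
        (ContinuousLinearMap.inr ℝ E ℝ) (fderiv ℝ (u ∘ (extChartAt 𝓜 x).symm) y) := by
    filter_upwards [h.eventuallyEq_nhds, hc.eventually (by simp)] with y hy hy'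
    rw [hy.fderiv_eq]
    refine ((hasFDerivAt_id y).prodMk
      (hy'.differentiableAt two_ne_zero).hasFDerivAt).fderiv.trans ?_
    ext <;> simp
  have hdd := (hc.fderiv_right (m := 1) (by norm_num)).differentiableAt one_ne_zero
  rw [h'.fderiv_eq]
  have hdp := (((ContinuousLinearMap.compL ℝ E ℝ (E × ℝ)
    (ContinuousLinearMap.inr ℝ E ℝ)).hasFDerivAt.comp _ hdd.hasFDerivAt).const_add
      (ContinuousLinearMap.inl ℝ E ℝ)).fderiv
  exact congrArg (fun l : E →L[ℝ] E →L[ℝ] E × ℝ => l v w) hdp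

/-! ### Normal parts and the second fundamental form of a graph -/

section Normal

variable [FiniteDimensional ℝ E] {g : BilinField E M} {ε : ℝ}

omit [FiniteDimensional ℝ E] in
theorem normalPart_add {P : Type*} {E' : Type*} [NormedAddCommGroup E'] [NormedSpace ℝ E']
    {H' : Type*} [TopologicalSpace H'] (I' : ModelWithCorners ℝ E' H') [TopologicalSpace P]
    [ChartedSpace H' P] (g : BilinField E' P) (F : M → P) (x : M) (z z' : E') :
    normalPart 𝓜 I' g F x (z + z') = normalPart 𝓜 I' g F x z + normalPart 𝓜 I' g F x z' := by
  simp [normalPart]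
  abel

omit [FiniteDimensional ℝ E] in
theorem normalPart_smul {P : Type*} {E' : Type*} [NormedAddCommGroup E'] [NormedSpace ℝ E']
    {H' : Type*} [TopologicalSpace H'] (I' : ModelWithCorners ℝ E' H') [TopologicalSpace P]
    [ChartedSpace H' P] (g : BilinField E' P) (F : M → P) (x : M) (c : ℝ) (z : E') :
    normalPart 𝓜 I' g F x (c • z) = c • normalPart 𝓜 I' g F x z := by
  simp [normalPart, smul_sub]

theorem normalPart_dmap {P : Type*} {E' : Type*} [NormedAddCommGroup E'] [NormedSpace ℝ E']
    {H' : Type*} [TopologicalSpace H'] (I' : ModelWithCorners ℝ E' H') [TopologicalSpace P]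
    [ChartedSpace H' P] {g : BilinField E' P} {F : M → P} {x : M}
    (h : ∀ v, (∀ w, inducedMetric 𝓜 I' g F x v w = 0) → v = 0) (v : E) :
    normalPart 𝓜 I' g F x (dmap 𝓜 I' F x v) = 0 := by
  have h1 : (g (F x) (dmap 𝓜 I' F x v)).comp (dmap 𝓜 I' F x) = inducedMetric 𝓜 I' g F x v := rfl
  rw [normalPart, h1, (isInvertible_of_nondegenerate h).inverse_apply_self, sub_self]

-- If `(0, 1)` were `(t, du(t))`, then `t = 0`, forcing `1 = du(0) = 0`.
omit [FiniteDimensional ℝ E] in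
theorem normalPart_vertical_ne_zero {x : M} (hu : MDifferentiableAt 𝓜 𝓘(ℝ, ℝ) u x) :
    normalPart 𝓜 𝓢 (prodMetric g ε) (fun x => (x, u x)) x (0, 1) ≠ 0 := by
  intro h
  rw [normalPart, dmap_graph hu, sub_eq_zero, Prod.mk.injEq] at h
  rw [← h.1, map_zero] at h
  exact one_ne_zero h.2

/-- The covariant derivative `(Γ, D²u)` differs from `Hess u · (0, 1)` by the tangent vector
`dF(Γ)`, which has no normal part. -/
theorem secondFundamentalForm_graph [IsManifold 𝓜 ∞ M] (hg : IsSemiRiemannianMetric 𝓜 g)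
    (hε : ε ≠ 0) (hu : ContMDiff 𝓜 𝓘(ℝ, ℝ) 2 u) {x : M}
    (h : ∀ v, (∀ w, inducedMetric 𝓜 𝓢 (prodMetric g ε) (fun x => (x, u x)) x v w = 0) → v = 0)
    (v w : E) :
    secondFundamentalForm 𝓜 𝓢 (prodMetric g ε) (fun x => (x, u x)) x v w =
      hessian g u x v w • normalPart 𝓜 𝓢 (prodMetric g ε) (fun x => (x, u x)) x (0, 1) := by
  have hd : MDifferentiableAt 𝓜 𝓘(ℝ, ℝ) u x := hu.mdifferentiable two_ne_zero x
  rw [secondFundamentalForm, fderiv_fderiv_graph hu, christoffel_prodMetric hg hε, dmap_graph hd,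
    dmap_graph hd, ← normalPart_smul]
  have key : ((0, fderiv ℝ (fderiv ℝ (u ∘ (extChartAt 𝓜 x).symm)) (extChartAt 𝓜 x x) v w) +
      (christoffel 𝓜 g x v w, 0) : E × ℝ) = hessian g u x v w • ((0, 1) : E × ℝ) +
        dmap 𝓜 𝓢 (fun x => (x, u x)) x (christoffel 𝓜 g x v w) := by
    rw [dmap_graph hd]
    simp [hessian]
  rw [key, normalPart_add, normalPart_dmap _ h, add_zero]

/-- A graph is a translating soliton iff the trace of the Hessian with respect to the induced
metric is `1`. -/
theorem meanCurvatureVector_graph_eq_iff [IsManifold 𝓜 ∞ M] (hg : IsSemiRiemannianMetric 𝓜 g)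
    (hε : ε ≠ 0) (hu : ContMDiff 𝓜 𝓘(ℝ, ℝ) 2 u) {x : M}
    (h : ∀ v, (∀ w, inducedMetric 𝓜 𝓢 (prodMetric g ε) (fun x => (x, u x)) x v w = 0) → v = 0) :
    meanCurvatureVector 𝓜 𝓢 (prodMetric g ε) (fun x => (x, u x)) x =
        normalPart 𝓜 𝓢 (prodMetric g ε) (fun x => (x, u x)) x (0, 1) ↔
      metricTrace (fun v w => inducedMetric 𝓜 𝓢 (prodMetric g ε) (fun x => (x, u x)) x v w)
        (hessian g u x) = 1 := by
  have h1 : secondFundamentalForm 𝓜 𝓢 (prodMetric g ε) (fun x => (x, u x)) x =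
      fun v w => hessian g u x v w •
        normalPart 𝓜 𝓢 (prodMetric g ε) (fun x => (x, u x)) x (0, 1) := by
    funext v w
    exact secondFundamentalForm_graph hg hε hu h v w
  have hn := normalPart_vertical_ne_zero (g := g) (ε := ε) (hu.mdifferentiable two_ne_zero x)
  rw [meanCurvatureVector, h1, metricTrace_smul_const]
  exact ⟨fun h => smul_left_injective ℝ hn (by simpa using h), fun h => by rw [h, one_smul]⟩

end Normal

end Graph

/-! ### Functions factoring through a semi-Riemannian submersion -/

section Submersion

variable {E : Type*} [NormedAddCommGroup E] [NormedSpace ℝ E] [FiniteDimensional ℝ E]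
  {M : Type*} [TopologicalSpace M] [ChartedSpace E M]

local notation "𝓜" => 𝓘(ℝ, E)
local notation "𝓢" => ModelWithCorners.prod 𝓘(ℝ, E) 𝓘(ℝ, ℝ)

omit [FiniteDimensional ℝ E] in
theorem christoffel_add_left (g : BilinField E M) (x : M) (v v' w : E) :
    christoffel 𝓜 g x (v + v') w = christoffel 𝓜 g x v w + christoffel 𝓜 g x v' w := by
  simp only [christoffel]
  rw [← map_add, ← smul_add]
  congr 2
  ext z
  simp
  ring

omit [FiniteDimensional ℝ E] in
theorem christoffel_smul_left (g : BilinField E M) (x : M) (c : ℝ) (v w : E) :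
    christoffel 𝓜 g x (c • v) w = c • christoffel 𝓜 g x v w := by
  simp only [christoffel]
  rw [← map_smul, smul_comm c]
  congr 2
  ext z
  simp
  ring

/-- The form `(v, w) ↦ g (∇_v X, w)` of a vector field `X`. -/
noncomputable def covDerivForm (g : BilinField E M) (X : M → E) (x : M) :
    LinearMap.BilinForm ℝ E :=
  LinearMap.mk₂ ℝ (fun v w => g x (covDeriv 𝓜 g X x v) w)
    (fun v v' w => by
      simp only [covDeriv, christoffel_add_left, map_add, add_apply]
      ring)
    (fun c v w => by
      simp only [covDeriv, christoffel_smul_left, map_smul, map_add, add_apply, smul_apply,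
        smul_eq_mul]
      ring)
    (fun v w w' => map_add _ _ _) (fun c v w => map_smul _ _ _)

/-- The gradient of a semi-Riemannian submersion onto `(J, δ ds²)` has constant square `δ`. -/
theorem differential_grad_eq {g : BilinField E M} (hg : IsSemiRiemannianMetric 𝓜 g) {δ : ℝ}
    (hδ : δ = 1 ∨ δ = -1) {J : Set ℝ} {π : M → ℝ} (hπ : IsSemiRiemannianSubmersion 𝓜 g δ J π)
    (x : M) : differential 𝓜 π x (grad 𝓜 g π x) = δ := by
  set N := grad 𝓜 g π x with hN
  have hgN : ∀ w, g x N w = differential 𝓜 π x w := fun w => by rw [hN, metric_grad hg]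
  have hk : ∀ z, differential 𝓜 π x z = 0 → g x N z = 0 := fun z hz => by rw [hgN, hz]
  have hi := hπ.isometry x N N hk hk
  rw [hgN] at hi
  have h0 : differential 𝓜 π x N ≠ 0 := by
    -- Otherwise `N` would be tangent to the fiber and orthogonal to it, hence zero, and `dπ = g(N,
    -- ·)` would not be surjective.
    intro h0
    have hN0 := hπ.fiber_nondegenerate x N h0 hk
    obtain ⟨w, hw⟩ := hπ.surjective x 1
    rw [← hgN, hN0] at hw
    simp at hw
  have h1 : δ * differential 𝓜 π x N = 1 := by
    apply mul_right_cancel₀ h0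
    linarith
  rcases hδ with rfl | rfl <;> linarith

/-- The trace of the Hessian of `f ∘ π` with respect to the metric induced on its graph. -/
theorem metricTrace_hessian_comp [IsManifold 𝓜 ∞ M] {g : BilinField E M}
    (hg : IsSemiRiemannianMetric 𝓜 g) {ε δ : ℝ} (hδ : δ = 1 ∨ δ = -1) {J : Set ℝ} {π : M → ℝ}
    (hπ : IsSemiRiemannianSubmersion 𝓜 g δ J π) {f : ℝ → ℝ} {x : M}
    (hf : ContDiffAt ℝ 2 f (π x)) (hW : δ + ε * deriv f (π x) ^ 2 ≠ 0) :
    metricTrace (fun v w => g x v w +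
        ε * (differential 𝓜 (f ∘ π) x v * differential 𝓜 (f ∘ π) x w)) (hessian g (f ∘ π) x) =
      deriv f (π x) * fiberMeanCurvature 𝓜 g π x +
        deriv (deriv f) (π x) / (δ + ε * deriv f (π x) ^ 2) := by
  have hδ2 : δ * δ = 1 := by rcases hδ with rfl | rfl <;> norm_num
  have hd : MDifferentiable 𝓜 𝓘(ℝ, ℝ) π := hπ.smooth.mdifferentiable (by simp)
  have hdN := differential_grad_eq hg hδ hπ x
  have hNN := hessian_grad_self_eq_zero hg hπ.smooth (differential_grad_eq hg hδ hπ) x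
  set N := grad 𝓜 g π x with hN
  have hgN : ∀ w, g x N w = differential 𝓜 π x w := fun w => by rw [hN, metric_grad hg]
  set a := deriv f (π x)
  set φ := differential 𝓜 π x
  let b : LinearMap.BilinForm ℝ E := LinearMap.mk₂ ℝ
    (fun v w => g x v w + ε * (differential 𝓜 (f ∘ π) x v * differential 𝓜 (f ∘ π) x w))
    (by intros; simp; ring) (by intros; simp; ring) (by intros; simp; ring)
    (by intros; simp; ring)
  -- The Hessian of `f ∘ π` as a bundled bilinear form, with `Hess π` written as `g(∇N, ·)` to match
  -- the fiber mean curvature.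
  let B : LinearMap.BilinForm ℝ E :=
    deriv (deriv f) (π x) • (LinearMap.BilinForm.linMulLin φ.toLinearMap φ.toLinearMap) +
      a • covDerivForm g (grad 𝓜 g π) x
  have hb : ∀ v w, b v w = g x v w + ε * (a ^ 2 * (φ v * φ w)) := by
    intro v w
    simp only [b, LinearMap.mk₂_apply, differential_comp (hd x) (hf.differentiableAt two_ne_zero),
      smul_apply, smul_eq_mul]
    ring
  have hB : ∀ v w, B v w =
      deriv (deriv f) (π x) * (φ v * φ w) + a * g x (covDeriv 𝓜 g (grad 𝓜 g π) x v) w :=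
    fun v w => rfl
  have hBh : hessian g (f ∘ π) x = fun v w => B v w := by
    funext v w
    rw [hB, hessian_comp g hπ.smooth hf, metric_covDeriv_grad hg hπ.smooth]
  have hφN : φ.toLinearMap N ≠ 0 := by
    change φ N ≠ 0
    rw [hdN]
    rintro rfl
    simp at hδ2
  have hbNN : b N N = δ + ε * a ^ 2 := by
    rw [hb, hgN, hdN, hδ2]
    ring
  have key := metricTrace_eq_add_of_orthogonal b B φ.toLinearMap N
    (fun v w => by rw [hb, hb, hg.symm]; ring) hφN
    (fun v hv => by
      replace hv : φ v = 0 := hv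
      rw [hb, hg.symm, hgN, hv]
      ring)
    (by rwa [hbNN])
    (fun v hv h => hπ.fiber_nondegenerate x v hv fun w hw => by
      have h1 := h w hw
      rw [hb, show φ v = 0 from hv] at h1
      simpa using h1)
  have hBN : B N N = deriv (deriv f) (π x) := by
    rw [hB, metric_covDeriv_grad hg hπ.smooth, hNN, hdN, hδ2]
    ring
  rw [hBh]
  change metricTrace (fun v w => b v w) _ = _
  rw [key, hbNN, hBN]
  congr 1
  -- On `ker dπ` all `dπ` terms vanish, leaving `g` and `f'` times the form whose trace is the fiber
  -- mean curvature.
  have hker : ∀ v : LinearMap.ker φ.toLinearMap, φ v = 0 := fun v => v.2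
  have e1 : (fun v w : LinearMap.ker φ.toLinearMap => b v w) =
      fun v w : LinearMap.ker φ.toLinearMap => g x v w := by
    funext v w
    simp [hb, hker]
  have e2 : (fun v w : LinearMap.ker φ.toLinearMap => B v w) =
      fun v w : LinearMap.ker φ.toLinearMap =>
        g x (covDeriv 𝓜 g (grad 𝓜 g π) x v) w • a := by
    funext v w
    simp [hB, hker, mul_comm]
  rw [e1, e2, metricTrace_smul_const, smul_eq_mul, mul_comm]
  rfl

omit [FiniteDimensional ℝ E] in
/-- The function `f` is `C²` if `f ∘ π` is. -/
theorem contDiffAt_of_comp_isSemiRiemannianSubmersion [IsManifold 𝓜 ∞ M] {g : BilinField E M}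
    {δ : ℝ} {J : Set ℝ} {π : M → ℝ}
    (hπ : IsSemiRiemannianSubmersion 𝓜 g δ J π) {f : ℝ → ℝ}
    (hu : ContMDiff 𝓜 𝓘(ℝ, ℝ) 2 (f ∘ π)) (x : M) : ContDiffAt ℝ 2 f (π x) := by
  have hx := mem_extChartAt_target (I := 𝓜) x
  have h := contDiffAt_of_comp_submersion (f := f) two_ne_zero
    ((contDiffAt_comp_extChartAt_symm hπ.smooth hx).of_le (by norm_cast)) ?_
    (contDiffAt_comp_extChartAt_symm hu hx)
  · rwa [Function.comp_apply, extChartAt_to_inv] at h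
  · rw [fderiv_comp_extChartAt_symm_self (hπ.smooth.mdifferentiable (by simp) x)]
    intro h0
    obtain ⟨v, hv⟩ := hπ.surjective x 1
    rw [h0] at hv
    simp at hv

end Submersion

end SemiRiem

/-! ### From the trace equation to the differential equation -/

theorem mainTheorem3
    {E : Type*} [NormedAddCommGroup E] [NormedSpace ℝ E] [FiniteDimensional ℝ E]
    {M : Type*} [TopologicalSpace M] [ChartedSpace E M] [IsManifold 𝓘(ℝ, E) ∞ M]
    (g : SemiRiem.BilinField E M) (hg : SemiRiem.IsSemiRiemannianMetric 𝓘(ℝ, E) g)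
    (ε δ : ℝ) (hε : ε = 1 ∨ ε = -1) (hδ : δ = 1 ∨ δ = -1)
    (J : Set ℝ) (hJ : IsOpen J) (hJ' : J.OrdConnected)
    (π : M → ℝ) (hπ : SemiRiem.IsSemiRiemannianSubmersion 𝓘(ℝ, E) g δ J π)
    (h : ℝ → ℝ) (hh : ∀ x, SemiRiem.fiberMeanCurvature 𝓘(ℝ, E) g π x = h (π x))
    (u : M → ℝ) (hu : ContMDiff 𝓘(ℝ, E) 𝓘(ℝ, ℝ) 2 u)
    (f : ℝ → ℝ) (hf : ∀ x, u x = f (π x))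
    (hgraph : SemiRiem.IsSemiRiemannianImmersion 𝓘(ℝ, E) (𝓘(ℝ, E).prod 𝓘(ℝ, ℝ))
      (SemiRiem.prodMetric g ε) (fun x => (x, u x))) :
    SemiRiem.IsTranslatingSoliton 𝓘(ℝ, E) 𝓘(ℝ, E) g ε (fun x => (x, u x)) ↔
      ContDiffOn ℝ 2 f J ∧
        ∀ s ∈ J, deriv (deriv f) s = (δ + ε * deriv f s ^ 2) * (1 - deriv f s * h s) := by
  have hε0 : ε ≠ 0 := by rcases hε with rfl | rfl <;> norm_num
  obtain rfl : u = f ∘ π := funext hf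
  have hδ2 : δ * δ = 1 := by rcases hδ with rfl | rfl <;> norm_num
  have hfx := SemiRiem.contDiffAt_of_comp_isSemiRiemannianSubmersion hπ hu
  have hd : MDifferentiable 𝓘(ℝ, E) 𝓘(ℝ, ℝ) π := hπ.smooth.mdifferentiable (by simp)
  have hud : MDifferentiable 𝓘(ℝ, E) 𝓘(ℝ, ℝ) (f ∘ π) := hu.mdifferentiable two_ne_zero
  -- Since `δ² = 1`, `γ(N, w) = δ (δ + ε f'²) dπ(w)`. If the factor vanished, nondegeneracy of `γ`
  -- would give `N = 0`, against `dπ(N) = δ`.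
  have hW : ∀ x, δ + ε * deriv f (π x) ^ 2 ≠ 0 := by
    intro x h0
    have hdN := SemiRiem.differential_grad_eq hg hδ hπ x
    have hN := hgraph.2 x (SemiRiem.grad 𝓘(ℝ, E) g π x) fun w => by
      rw [SemiRiem.inducedMetric_graph g ε (hud x), SemiRiem.metric_grad hg,
        SemiRiem.differential_comp (hd x) ((hfx x).differentiableAt two_ne_zero)]
      simp only [smul_apply, smul_eq_mul, hdN]
      linear_combination δ * SemiRiem.differential 𝓘(ℝ, E) π x w * h0 -
        SemiRiem.differential 𝓘(ℝ, E) π x w * hδ2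
    rw [hN, map_zero] at hdN
    rw [← hdN] at hδ2
    simp at hδ2
  have hpt : ∀ x, SemiRiem.meanCurvatureVector 𝓘(ℝ, E) (𝓘(ℝ, E).prod 𝓘(ℝ, ℝ))
        (SemiRiem.prodMetric g ε) (fun x => (x, (f ∘ π) x)) x =
      SemiRiem.normalPart 𝓘(ℝ, E) (𝓘(ℝ, E).prod 𝓘(ℝ, ℝ)) (SemiRiem.prodMetric g ε)
        (fun x => (x, (f ∘ π) x)) x (0, 1) ↔
      deriv (deriv f) (π x) =
        (δ + ε * deriv f (π x) ^ 2) * (1 - deriv f (π x) * h (π x)) := by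
    intro x
    rw [SemiRiem.meanCurvatureVector_graph_eq_iff hg hε0 hu (hgraph.2 x)]
    have e : (fun v w => SemiRiem.inducedMetric 𝓘(ℝ, E) (𝓘(ℝ, E).prod 𝓘(ℝ, ℝ))
        (SemiRiem.prodMetric g ε) (fun x => (x, (f ∘ π) x)) x v w) = _ :=
      funext fun v => funext fun w => SemiRiem.inducedMetric_graph g ε (hud x) v w
    rw [e, SemiRiem.metricTrace_hessian_comp hg hδ hπ (hfx x) (hW x), hh]
    rw [← eq_sub_iff_add_eq', div_eq_iff (hW x), mul_comm (1 - _)]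
  constructor
  · intro hs
    refine ⟨fun s hs' => ?_, fun s hs' => ?_⟩
    all_goals
      -- Every point of `J` is a value of `π`, so statements at points of `M` become statements on
      -- all of `J`.
      rw [← hπ.range_eq] at hs'
      obtain ⟨x, rfl⟩ := hs'
    · exact (hfx x).contDiffWithinAt
    · exact (hpt x).1 (hs.2 x)
  · rintro ⟨-, hs⟩
    refine ⟨hgraph, fun x => (hpt x).2 (hs _ ?_)⟩
    rw [← hπ.range_eq]
    exact ⟨x, rfl⟩
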